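/- Let $d\in\mathbb{N}$ and let $X\in\mathbb{C}^{d\times d}$ be a matrix, not necessarily diagonalizable, all of whose eigenvalues are real. Let $f:\mathbb{R}\to\mathbb{C}$ be $2\pi$-periodic and of class $C^{d-1}$ (continuous if $d\le 1$), with Fourier coefficients \[ \widehat f(k)=\frac1{2\pi}\int_{-\pi}^{\pi} f(x)e^{-ikx}\,dx,\qquad k\in\mathbb{Z}. \] Define $f(X)$ through the Jordan form: if $X=W\operatorname{diag}(J_1,\dots,J_r)W^{-1}$ is a Jordan decomposition, where $J_i$ is a Jordan block (ones on the superdiagonal) of size $d_i\ge 1$ with eigenvalue $\lambda_i\in\mathbb{R}$, then \[ f(X)=W\operatorname{diag}\bigl(f(J_1),\dots,f(J_r)\bigr)W^{-1}, \] where $f(J_i)$ is the upper triangular $d_i\times d_i$ matrix with $(p,q)$ entry $f^{(q-p)}(\lambda_i)/(q-p)!$ for $p\le q$ and $0$ for $p>q$. Then $f(X)$ is well defined, i.e., a Jordan decomposition of this form exists and the value of $f(X)$ does not depend on which one is chosen, and \[ \lim_{n\to\infty}\frac1n\sum_{m=0}^{n-1}\sum_{k=-m}^{m}\widehat f(k)\,e^{ikX}=f(X).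 \] -/

import Mathlib

/-- The `m × m` Jordan block with (real) eigenvalue `t`: `t` on the diagonal, `1` on the
superdiagonal, `0` elsewhere. -/
def jordanBlock (m : ℕ) (t : ℝ) : Matrix (Fin m) (Fin m) ℂ :=
  Matrix.of fun p q =>
    if p = q then (t : ℂ) else if (p : ℕ) + 1 = (q : ℕ) then 1 else 0

/-- The value `f(J)` at the `m × m` Jordan block `J` with eigenvalue `t`: the upper triangular
matrix whose `(p, q)` entry is `f^{(q-p)}(t) / (q-p)!` for `p ≤ q`. -/
noncomputable def jordanBlockFunction (f : ℝ → ℂ) (m : ℕ) (t : ℝ) :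
    Matrix (Fin m) (Fin m) ℂ :=
  Matrix.of fun p q =>
    if p ≤ q then
      iteratedDeriv ((q : ℕ) - (p : ℕ)) f t / (Nat.factorial ((q : ℕ) - (p : ℕ)) : ℂ)
    else 0

/-- A Jordan decomposition `X = W diag(J₁, …, J_r) W⁻¹` of a complex `d × d` matrix all of whose
eigenvalues are real. The equivalence `e` lists the basis vectors belonging to the blocks as
`0, …, d - 1`. -/
structure RealJordanDecomposition {d : ℕ} (X : Matrix (Fin d) (Fin d) ℂ) where
  /-- number of blocks -/
  r : ℕ
  /-- sizes of the blocks -/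
  size : Fin r → ℕ
  size_pos : ∀ i, 0 < size i
  /-- eigenvalues of the blocks -/
  eig : Fin r → ℝ
  e : (Σ i, Fin (size i)) ≃ Fin d
  /-- the invertible change of basis -/
  W : (Matrix (Fin d) (Fin d) ℂ)ˣ
  eq : X = (W : Matrix (Fin d) (Fin d) ℂ)
    * Matrix.reindex e e (Matrix.blockDiagonal' fun i => jordanBlock (size i) (eig i))
    * ((W⁻¹ : (Matrix (Fin d) (Fin d) ℂ)ˣ) : Matrix (Fin d) (Fin d) ℂ)

/-- The matrix `W diag(f(J₁), …, f(J_r)) W⁻¹` attached to a Jordan decomposition. -/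
noncomputable def RealJordanDecomposition.applyFunction {d : ℕ} {X : Matrix (Fin d) (Fin d) ℂ}
    (D : RealJordanDecomposition X) (f : ℝ → ℂ) : Matrix (Fin d) (Fin d) ℂ :=
  (D.W : Matrix (Fin d) (Fin d) ℂ)
    * Matrix.reindex D.e D.e
        (Matrix.blockDiagonal' fun i => jordanBlockFunction f (D.size i) (D.eig i))
    * ((D.W⁻¹ : (Matrix (Fin d) (Fin d) ℂ)ˣ) : Matrix (Fin d) (Fin d) ℂ)

/-- `F` is a value of `f(X)`, computed through some Jordan decomposition of `X`. -/
def IsMatrixFunction {d : ℕ} (f : ℝ → ℂ) (X F : Matrix (Fin d) (Fin d) ℂ) : Prop :=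
  ∃ D : RealJordanDecomposition X, D.applyFunction f = F

/-- The Fourier coefficient `(1 / 2π) ∫_{-π}^{π} f(x) e^{-ikx} dx`. -/
noncomputable def fourierHat (f : ℝ → ℂ) (k : ℤ) : ℂ :=
  fourierCoeffOn (neg_lt_self Real.pi_pos) f k

/-- The symmetric partial sum `∑_{k=-m}^{m} f̂(k) e^{ikX}` of the matrix Fourier series. -/
noncomputable def matrixFourierPartialSum {d : ℕ} (f : ℝ → ℂ) (X : Matrix (Fin d) (Fin d) ℂ)
    (m : ℕ) : Matrix (Fin d) (Fin d) ℂ :=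
  ∑ k ∈ Finset.Icc (-(m : ℤ)) (m : ℤ),
    fourierHat f k • NormedSpace.exp ((Complex.I * (k : ℂ)) • X)

/-- The Cesàro (Fejér) mean `(1 / n) ∑_{m=0}^{n-1} ∑_{k=-m}^{m} f̂(k) e^{ikX}`. -/
noncomputable def matrixFejerMean {d : ℕ} (f : ℝ → ℂ) (X : Matrix (Fin d) (Fin d) ℂ)
    (n : ℕ) : Matrix (Fin d) (Fin d) ℂ :=
  (1 / (n : ℂ)) • ∑ m ∈ Finset.range n, matrixFourierPartialSum f X m

/-! Fix a Jordan decomposition of X. Conjugation passes through the exponential, so the Fejér mean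
of X is W diag(Fejér means of the blocks) W⁻¹. On a block with eigenvalue t, the (p, q) entry of
e^{ikJ} with j = q - p ≥ 0 is (ik)^j e^{ikt} / j!. Since (ik)^j f̂(k) is the k-th Fourier
coefficient of f^{(j)}, that entry of the mean is the scalar Fejér mean of f^{(j)} at t, over j!.
Scalar Fejér gives the limit f^{(j)}(t) / j!.

The means are defined without any decomposition, so uniqueness of limits makes f(X) independent of
the choice. Existence of a decomposition comes from the structure theorem for torsion modules over
K[X], with X acting as the endomorphism.

The ingredients are `LinearMap.exists_jordan_basis`, `tendsto_fejerMean`, `fourierHat_iteratedDeriv`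
and `exp_smul_jordanBlock_apply`. -/

/-! ### Existence of the Jordan form. -/

theorem DFinsupp.basis_apply {ι R : Type*} {M : ι → Type*} [DecidableEq ι] [Semiring R]
    [∀ i, AddCommMonoid (M i)] [∀ i, Module R (M i)] {η : ι → Type*}
    (b : ∀ i, Module.Basis (η i) R (M i)) (i : ι) (j : η i) :
    DFinsupp.basis b ⟨i, j⟩ = DFinsupp.single i (b i j) := by
  classical
  apply (DFinsupp.basis b).repr.injective
  rw [Module.Basis.repr_self]
  ext ⟨i', j'⟩
  change _ = (b i').repr (DFinsupp.single i (b i j) i') j'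
  rcases eq_or_ne i i' with rfl | h
  · simp [Finsupp.single_apply]
  · rw [DFinsupp.single_eq_of_ne h.symm, map_zero, Finsupp.single_eq_of_ne]
    · rfl
    · rintro ⟨⟩
      exact h rfl

open Polynomial in
/-- The classes of the powers of `X - a` form a Jordan chain that is a basis of
`K[X] / ((X - a) ^ e)`. -/
theorem exists_jordan_basis_quotient {K : Type*} [Field K] (a : K) (e : ℕ) :
    ∃ b : Module.Basis (Fin e) K (K[X] ⧸ Submodule.span K[X] {(X - C a) ^ e}),
      ∀ j : Fin e, (X : K[X]) • b j =
        a • b j + if 0 < (j : ℕ) then b ⟨j - 1, by omega⟩ else 0 := by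
  set I : Submodule K[X] K[X] := Submodule.span K[X] {(X - C a) ^ e} with hI
  -- Multiplication by X - a raises the exponent; the exponents are listed in reverse so that it
  -- lowers the index, matching ones on the superdiagonal.
  let v : Fin e → K[X] ⧸ I := fun j => I.mkQ ((X - C a) ^ (e - 1 - (j : ℕ)))
  have hli' : LinearIndependent K (fun j : Fin e => I.mkQ ((X - C a) ^ (j : ℕ))) := by
    rw [Fintype.linearIndependent_iff]
    intro g hg
    have h1 : (∑ j : Fin e, C (g j) * (X - C a) ^ (j : ℕ)) ∈ I := by
      rw [← Submodule.ker_mkQ I, LinearMap.mem_ker, map_sum, ← hg]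
      refine Finset.sum_congr rfl fun j _ => ?_
      rw [← smul_eq_mul, map_smul, ← algebraMap_eq, algebraMap_smul]
    rw [hI, Submodule.mem_span_singleton] at h1
    obtain ⟨q, hq⟩ := h1
    -- Translating by a turns the relation into divisibility by X ^ e of a polynomial of degree
    -- below e, so every coefficient vanishes.
    have h2 := congrArg (fun p : K[X] => p.comp (X + C a)) hq
    simp only [smul_eq_mul, mul_comp, pow_comp, sub_comp, X_comp, C_comp, add_sub_cancel_right,
      Polynomial.sum_comp] at h2
    have h3 := (X_pow_dvd_iff (n := e)).1 (Dvd.intro_left _ h2)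
    intro i
    have := h3 i i.2
    simpa [finsetSum_coeff, coeff_X_pow, Fin.val_inj] using this
  have hli : LinearIndependent K v :=
    hli'.comp (fun j : Fin e => (⟨e - 1 - j, by omega⟩ : Fin e)) (by
      intro i j h
      simp only [Fin.mk.injEq] at h
      ext
      omega)
  have hcard : Fintype.card (Fin e) = Module.finrank K (K[X] ⧸ I) := by
    have := finrank_quotient_span_eq_natDegree (K := K) (f := (X - C a) ^ e)
    rw [natDegree_pow, natDegree_X_sub_C, mul_one] at this
    rw [Fintype.card_fin]
    exact this.symm
  rcases Nat.eq_zero_or_pos e with rfl | he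
  · have : Module.Finite K (K[X] ⧸ I) :=
      ((monic_X_sub_C a).pow 0).finite_quotient
    exact ⟨Module.finBasisOfFinrankEq K _ (by simpa using hcard.symm), fun j => j.elim0⟩
  have : Nonempty (Fin e) := ⟨⟨0, he⟩⟩
  refine ⟨basisOfLinearIndependentOfCardEqFinrank hli hcard, fun j => ?_⟩
  simp only [coe_basisOfLinearIndependentOfCardEqFinrank, v]
  have h4 : (X : K[X]) • I.mkQ ((X - C a) ^ (e - 1 - (j : ℕ))) =
      a • I.mkQ ((X - C a) ^ (e - 1 - (j : ℕ))) + I.mkQ ((X - C a) ^ (e - 1 - (j : ℕ) + 1)) := by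
    rw [← algebraMap_smul K[X] a, ← map_smul, ← map_smul, ← map_add, algebraMap_eq]
    congr 1
    simp only [smul_eq_mul]
    ring
  rw [h4]
  congr 1
  split_ifs with h
  · congr 2
    omega
  · rw [← LinearMap.mem_ker, Submodule.ker_mkQ, show e - 1 - (j : ℕ) + 1 = e by omega]
    exact Submodule.mem_span_singleton_self _

open Polynomial in
/-- **Jordan normal form**: an endomorphism of a finite-dimensional vector space over an
algebraically closed field has a basis made of Jordan chains. -/
theorem LinearMap.exists_jordan_basis {K V : Type*} [Field K] [IsAlgClosed K] [AddCommGroup V]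
    [Module K V] [FiniteDimensional K V] (A : V →ₗ[K] V) :
    ∃ (r : ℕ) (size : Fin r → ℕ) (eig : Fin r → K) (b : Module.Basis (Σ i, Fin (size i)) K V),
      (∀ i, 0 < size i) ∧ ∀ i (j : Fin (size i)), A (b ⟨i, j⟩) =
        eig i • b ⟨i, j⟩ + if 0 < (j : ℕ) then b ⟨i, ⟨j - 1, by omega⟩⟩ else 0 := by
  classical
  obtain ⟨ι, _, p, hp, e, ⟨g⟩⟩ := Module.equiv_directSum_of_isTorsion
    (Module.AEval.isTorsion_of_finiteDimensional K V A)
  have hroot : ∀ i, ∃ a : K, Submodule.span K[X] {p i ^ e i} =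
      Submodule.span K[X] {(X - C a) ^ e i} := by
    intro i
    obtain ⟨a, ha⟩ := IsAlgClosed.exists_root (p i)
      (IsAlgClosed.degree_eq_one_of_irreducible K (hp i) ▸ one_ne_zero)
    refine ⟨a, ?_⟩
    have h := ((irreducible_X_sub_C a).associated_of_dvd (hp i) (dvd_iff_isRoot.2 ha)).symm
    exact Ideal.span_singleton_eq_span_singleton.2 (h.pow_pow)
  choose a ha using hroot
  have hb : ∀ i, ∃ b : Module.Basis (Fin (e i)) K (K[X] ⧸ Submodule.span K[X] {p i ^ e i}),
      ∀ j : Fin (e i), (X : K[X]) • b j =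
        a i • b j + if 0 < (j : ℕ) then b ⟨j - 1, by omega⟩ else 0 := by
    intro i
    rw [ha i]
    exact exists_jordan_basis_quotient (a i) (e i)
  choose b hb using hb
  let B0 : Module.Basis (Σ i, Fin (e i)) K (Module.AEval K V A) :=
    (DFinsupp.basis b).map (g.restrictScalars K).symm
  have hB0 : ∀ i (j : Fin (e i)), (X : K[X]) • B0 ⟨i, j⟩ =
        a i • B0 ⟨i, j⟩ + if 0 < (j : ℕ) then B0 ⟨i, ⟨j - 1, by omega⟩⟩ else 0 := by
    have hval : ∀ i (j : Fin (e i)), B0 ⟨i, j⟩ = g.symm (DirectSum.lof K[X] ι _ i (b i j)) := by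
      intro i j
      simp only [B0, Module.Basis.map_apply, DFinsupp.basis_apply]
      rfl
    intro i j
    simp only [hval]
    rw [← map_smul, ← map_smul, hb, map_add, map_add]
    congr 1
    · rw [← algebraMap_smul K[X] (a i) (b i j), map_smul, map_smul, algebraMap_smul]
    · split_ifs <;> simp
  let B : Module.Basis (Σ i, Fin (e i)) K V := B0.map (Module.AEval.of K V A).symm
  have hB : ∀ i (j : Fin (e i)), A (B ⟨i, j⟩) =
        a i • B ⟨i, j⟩ + if 0 < (j : ℕ) then B ⟨i, ⟨j - 1, by omega⟩⟩ else 0 := by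
    intro i j
    have := congrArg (Module.AEval.of K V A).symm (hB0 i j)
    rw [Module.AEval.of_symm_X_smul] at this
    simp only [B, Module.Basis.map_apply]
    refine this.trans ?_
    rw [map_add, map_smul]
    split_ifs <;> simp
  -- The structure theorem allows exponent 0; these summands are trivial and are discarded to keep
  -- the block sizes positive.
  let S := {i : ι // 0 < e i}
  let φ : S ≃ Fin (Fintype.card S) := Fintype.equivFin S
  let ψ : (Σ k : Fin (Fintype.card S), Fin (e (φ.symm k).1)) ≃ Σ i, Fin (e i) :=
    (Equiv.sigmaCongrLeft (β := fun s : S => Fin (e s.1)) φ.symm).trans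
      (Equiv.sigmaSubtypeEquivOfSubset (fun i => Fin (e i)) (fun i => 0 < e i)
        fun i j => j.pos)
  refine ⟨Fintype.card S, fun k => e (φ.symm k).1, fun k => a (φ.symm k).1, B.reindex ψ.symm,
    fun k => (φ.symm k).2, fun k j => ?_⟩
  simp only [Module.Basis.reindex_apply, Equiv.symm_symm]
  exact hB (φ.symm k).1 j

/-- A complex matrix all of whose eigenvalues are real has a Jordan decomposition. -/
theorem nonempty_realJordanDecomposition {d : ℕ} (X : Matrix (Fin d) (Fin d) ℂ)
    (hX : ∀ z ∈ spectrum ℂ X, z.im = 0) : Nonempty (RealJordanDecomposition X) := by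
  obtain ⟨r, size, eig, b, hpos, hb⟩ := (Matrix.toLin' X).exists_jordan_basis
  have hreal : ∀ i, ((eig i).re : ℂ) = eig i := by
    intro i
    -- The first vector of each chain is an eigenvector, so its eigenvalue lies in the spectrum.
    have h := hb i ⟨0, hpos i⟩
    rw [if_neg (lt_irrefl _), add_zero] at h
    have hev : Module.End.HasEigenvalue (Matrix.toLin' X) (eig i) :=
      Module.End.hasEigenvalue_of_hasEigenvector
        ⟨Module.End.mem_eigenspace_iff.2 h, b.ne_zero _⟩
    have hz := hX (eig i) (by rw [← Matrix.spectrum_toLin']; exact hev.mem_spectrum)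
    exact Complex.ext (by simp) (by simp [hz])
  have hcard : Fintype.card (Σ i, Fin (size i)) = d := by
    rw [← Module.finrank_eq_card_basis b]
    simp
  let e : (Σ i, Fin (size i)) ≃ Fin d := Fintype.equivFinOfCardEq hcard
  let b' := b.reindex e
  let s := Pi.basisFun ℂ (Fin d)
  refine ⟨⟨r, size, hpos, fun i => (eig i).re, e,
    ⟨s.toMatrix b', b'.toMatrix s, s.toMatrix_mul_toMatrix_flip b',
      b'.toMatrix_mul_toMatrix_flip s⟩, ?_⟩⟩
  change X = s.toMatrix b' * _ * b'.toMatrix s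
  have hM : Matrix.reindex e e (Matrix.blockDiagonal' fun i => jordanBlock (size i) (eig i).re) =
      LinearMap.toMatrix b' b' (Matrix.toLin' X) := by
    ext p q
    obtain ⟨⟨i, j⟩, rfl⟩ := e.surjective p
    obtain ⟨⟨i', j'⟩, rfl⟩ := e.surjective q
    rw [LinearMap.toMatrix_apply]
    simp only [b', Module.Basis.reindex_apply, Equiv.symm_apply_apply, hb, Matrix.reindex_apply,
      Matrix.submatrix_apply, Module.Basis.repr_reindex_apply, map_add, map_smul,
      Module.Basis.repr_self, Finsupp.add_apply, Finsupp.smul_apply]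
    rcases eq_or_ne i i' with rfl | hne
    · rw [Matrix.blockDiagonal'_apply_eq]
      by_cases h : 0 < (j' : ℕ)
      · rw [if_pos h, Module.Basis.repr_self]
        by_cases h1 : j = j'
        · subst h1
          have : (⟨(j : ℕ) - 1, by omega⟩ : Fin (size i)) ≠ j := fun h => by
            have := congrArg Fin.val h
            simp only at this
            omega
          simp [jordanBlock, hreal, this]
        · by_cases h2 : (j : ℕ) + 1 = j'
          · have : (⟨(j' : ℕ) - 1, by omega⟩ : Fin (size i)) = j := Fin.ext (by simp; omega)
            simp [jordanBlock, h1, h2, this]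
          · have : (⟨(j' : ℕ) - 1, by omega⟩ : Fin (size i)) ≠ j := fun h => by
              have := congrArg Fin.val h
              simp only at this
              omega
            simp [jordanBlock, h1, h2, this]
      · rw [if_neg h, map_zero]
        have h2 : (j : ℕ) + 1 ≠ j' := by omega
        by_cases h1 : j = j'
        · simp [jordanBlock, hreal, h1]
        · simp [jordanBlock, h1, h2]
    · rw [Matrix.blockDiagonal'_apply_ne _ _ _ hne]
      split_ifs <;> simp [Ne.symm hne]
  rw [hM, basis_toMatrix_mul_linearMap_toMatrix_mul_basis_toMatrix]
  exact (LinearMap.toMatrix'_toLin' X).symm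
-- Fejér's theorem on the circle.
section Fejer
open MeasureTheory AddCircle Filter Topology

variable {T : ℝ}

/-- The closed form of the Fejér kernel. -/
theorem sum_fourier_eq_normSq (n : ℕ) (z : AddCircle T) :
    ∑ m ∈ Finset.range n, ∑ k ∈ Finset.Icc (-(m : ℤ)) m, fourier k z =
      ((‖∑ l ∈ Finset.range n, fourier (l : ℤ) z‖ ^ 2 : ℝ) : ℂ) := by
  have hD : ∀ m : ℕ, ∑ k ∈ Finset.Icc (-(m : ℤ)) m, fourier k z =
      1 + ∑ l ∈ Finset.range m, (fourier ((l : ℤ) + 1) z + fourier (-((l : ℤ) + 1)) z) := by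
    intro m
    induction m with
    | zero => simp
    | succ m ih =>
      have : Finset.Icc (-((m + 1 : ℕ) : ℤ)) ((m + 1 : ℕ) : ℤ) =
          insert ((m : ℤ) + 1) (insert (-((m : ℤ) + 1)) (Finset.Icc (-(m : ℤ)) m)) := by
        ext k
        simp only [Finset.mem_Icc, Finset.mem_insert]
        push_cast
        omega
      rw [this, Finset.sum_insert, Finset.sum_insert, ih, Finset.sum_range_succ]
      · ring
      · simp
      · simp only [Finset.mem_insert, Finset.mem_Icc]
        omega
  rw [Complex.ofReal_pow, ← Complex.mul_conj', map_sum]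
  simp_rw [← fourier_neg]
  induction n with
  | zero => simp
  | succ n ih =>
    -- Passing from n to n + 1 in the squared modulus adds two cross terms, the negative and the
    -- positive frequencies of the Dirichlet kernel, and the constant 1.
    have h1 : (∑ l ∈ Finset.range n, fourier (l : ℤ) z) * fourier (-(n : ℤ)) z =
        ∑ l ∈ Finset.range n, fourier (-((l : ℤ) + 1)) z := by
      rw [← Finset.sum_range_reflect, Finset.sum_mul]
      refine Finset.sum_congr rfl fun l hl => ?_
      have := Finset.mem_range.1 hl
      rw [← fourier_add]
      congr 2
      omega
    have h2 : fourier (n : ℤ) z * (∑ l ∈ Finset.range n, fourier (-(l : ℤ)) z) =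
        ∑ l ∈ Finset.range n, fourier ((l : ℤ) + 1) z := by
      rw [← Finset.sum_range_reflect, Finset.mul_sum]
      refine Finset.sum_congr rfl fun l hl => ?_
      have := Finset.mem_range.1 hl
      rw [← fourier_add]
      congr 2
      omega
    have h3 : fourier (n : ℤ) z * fourier (-(n : ℤ)) z = 1 := by
      rw [← fourier_add, add_neg_cancel, fourier_zero]
    rw [Finset.sum_range_succ, ih, hD, Finset.sum_range_succ (fun l : ℕ => fourier (l : ℤ) z),
      Finset.sum_range_succ (fun l : ℕ => fourier (-(l : ℤ)) z), add_mul, mul_add, mul_add, h1, h2,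
      h3, Finset.sum_add_distrib]
    ring

variable [hT : Fact (0 < T)]

/-- The Fejér mean at `x` of the Fourier series of `f`. -/
noncomputable def fejerMean (f : AddCircle T → ℂ) (n : ℕ) (x : AddCircle T) : ℂ :=
  (1 / (n : ℂ)) * ∑ m ∈ Finset.range n, ∑ k ∈ Finset.Icc (-(m : ℤ)) m,
    fourierCoeff f k * fourier k x

theorem fejerMean_sub (f g : C(AddCircle T, ℂ)) (n : ℕ) (x : AddCircle T) :
    fejerMean (⇑f - ⇑g) n x = fejerMean f n x - fejerMean g n x := by
  have : ∀ k, fourierCoeff (⇑f - ⇑g) k = fourierCoeff f k - fourierCoeff g k := by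
    intro k
    have hi : ∀ f : C(AddCircle T, ℂ), Integrable f haarAddCircle := fun f =>
      f.continuous.integrable_of_hasCompactSupport (HasCompactSupport.of_compactSpace _)
    rw [sub_eq_add_neg, ← neg_one_smul ℂ (g : AddCircle T → ℂ),
      fourierCoeff.add (hi f) ((hi g).smul _), Pi.add_apply, fourierCoeff.const_smul]
    simp [sub_eq_add_neg]
  simp only [fejerMean, this, sub_mul, Finset.sum_sub_distrib, mul_sub]

theorem fejerMean_eq_integral (f : C(AddCircle T, ℂ)) (n : ℕ) (x : AddCircle T) :
    fejerMean f n x = ∫ y, ((1 / (n : ℝ) *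
      ‖∑ l ∈ Finset.range n, fourier (l : ℤ) (x - y)‖ ^ 2 : ℝ) : ℂ) * f y ∂haarAddCircle := by
  have hi : ∀ f : C(AddCircle T, ℂ), Integrable f haarAddCircle := fun f =>
    f.continuous.integrable_of_hasCompactSupport (HasCompactSupport.of_compactSpace _)
  have hk : ∀ k, Integrable (fun y => fourier k (x - y) * f y) haarAddCircle := fun k =>
    hi ⟨fun y => fourier k (x - y) * f y, by fun_prop⟩
  have hF : ∀ k, fourierCoeff f k * fourier k x =
      ∫ y, fourier k (x - y) * f y ∂haarAddCircle := by
    intro k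
    rw [fourierCoeff, ← integral_mul_const]
    refine integral_congr_ae (Eventually.of_forall fun y => ?_)
    have : fourier k (x - y) = fourier k x * fourier (-k) y := by
      rw [fourier_apply, fourier_apply, fourier_apply, smul_sub, sub_eq_add_neg,
        AddCircle.toCircle_add, Circle.coe_mul, neg_smul]
    simp only [this, smul_eq_mul]
    ring
  simp only [Complex.ofReal_mul, ← sum_fourier_eq_normSq, mul_assoc, integral_const_mul,
    Finset.sum_mul, fejerMean, hF]
  push_cast
  congr 1
  rw [integral_finsetSum _ fun m _ => integrable_finsetSum _ fun k _ => hk k]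
  refine Finset.sum_congr rfl fun m _ => ?_
  rw [integral_finsetSum _ fun k _ => hk k]

theorem tendsto_fejerMean_fourier (j : ℤ) (x : AddCircle T) :
    Tendsto (fun n => fejerMean (fourier j : C(AddCircle T, ℂ)) n x) atTop (𝓝 (fourier j x)) := by
  have h : Tendsto (fun m : ℕ => ∑ k ∈ Finset.Icc (-(m : ℤ)) m,
      fourierCoeff (fourier j : C(AddCircle T, ℂ)) k * fourier k x) atTop (𝓝 (fourier j x)) := by
    -- The partial sums are constant once m ≥ |j|, and Cesàro means keep the limit.
    refine tendsto_const_nhds.congr' ?_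
    filter_upwards [eventually_ge_atTop j.natAbs] with m hm
    rw [fourierCoeff_fourier, Finset.sum_eq_single j]
    · simp
    · intro k _ hk
      simp [hk]
    · intro hj
      exact absurd (Finset.mem_Icc.2 ⟨by omega, by omega⟩) hj
  refine h.cesaro_smul.congr fun n => ?_
  rw [fejerMean, Complex.real_smul]
  push_cast
  rw [one_div]

theorem fejerMean_one {n : ℕ} (hn : n ≠ 0) (x : AddCircle T) :
    fejerMean (1 : C(AddCircle T, ℂ)) n x = 1 := by
  have h1 : (1 : C(AddCircle T, ℂ)) = fourier 0 := by ext; simp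
  have : ∀ m : ℕ, ∑ k ∈ Finset.Icc (-(m : ℤ)) m,
      fourierCoeff (fourier 0 : C(AddCircle T, ℂ)) k * fourier k x = 1 := by
    intro m
    rw [fourierCoeff_fourier, Finset.sum_eq_single 0]
    · simp
    · intro k _ hk
      simp [hk]
    · simp
  rw [h1, fejerMean, Finset.sum_congr rfl fun m _ => this m]
  simp [hn]

/-- The Fejér kernel is nonnegative, and the means of the constant 1 show that its integral is 1;
hence each mean is a weighted average. This bound, uniform in n, carries convergence from
trigonometric polynomials to their uniform closure. -/
theorem norm_fejerMean_le (f : C(AddCircle T, ℂ)) (n : ℕ) (x : AddCircle T) :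
    ‖fejerMean f n x‖ ≤ ‖f‖ := by
  rcases eq_or_ne n 0 with rfl | hn
  · simp [fejerMean]
  have h1 := fejerMean_one hn x
  rw [fejerMean_eq_integral] at h1 ⊢
  simp only [ContinuousMap.one_apply, mul_one, integral_complex_ofReal] at h1
  have h2 := Complex.ofReal_injective (h1.trans Complex.ofReal_one.symm)
  set K : AddCircle T → ℝ := fun y =>
    1 / (n : ℝ) * ‖∑ l ∈ Finset.range n, fourier (l : ℤ) (x - y)‖ ^ 2 with hK
  have hK0 : ∀ y, 0 ≤ K y := fun y => by positivity
  have hKc : Continuous K := by fun_prop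
  calc ‖∫ y, (K y : ℂ) * f y ∂haarAddCircle‖ ≤ ∫ y, K y * ‖f‖ ∂haarAddCircle := by
        refine norm_integral_le_of_norm_le
          ((hKc.mul_const _).integrable_of_hasCompactSupport (HasCompactSupport.of_compactSpace _))
          (Eventually.of_forall fun y => ?_)
        rw [norm_mul, Complex.norm_real, Real.norm_of_nonneg (hK0 y)]
        exact mul_le_mul_of_nonneg_left (f.norm_coe_le_norm y) (hK0 y)
    _ = ‖f‖ := by rw [integral_mul_const, h2, one_mul]

theorem fejerMean_add (f g : C(AddCircle T, ℂ)) (n : ℕ) (x : AddCircle T) :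
    fejerMean (⇑f + ⇑g) n x = fejerMean f n x + fejerMean g n x := by
  have := fejerMean_sub (f + g) g n x
  simp only [ContinuousMap.coe_add, add_sub_cancel_right] at this
  rw [this]
  ring

theorem fejerMean_smul (c : ℂ) (f : AddCircle T → ℂ) (n : ℕ) (x : AddCircle T) :
    fejerMean (c • f) n x = c * fejerMean f n x := by
  simp only [fejerMean, fourierCoeff.const_smul, smul_eq_mul, mul_assoc, ← Finset.mul_sum]
  ring

/-- **Fejér's theorem**, pointwise form, on the circle. -/
theorem tendsto_fejerMean (f : C(AddCircle T, ℂ)) (x : AddCircle T) :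
    Tendsto (fun n => fejerMean f n x) atTop (𝓝 (f x)) := by
  have hspan : ∀ g ∈ Submodule.span ℂ (Set.range (@fourier T)),
      Tendsto (fun n => fejerMean g n x) atTop (𝓝 (g x)) := by
    intro g hg
    induction hg using Submodule.span_induction with
    | mem g hg =>
      obtain ⟨j, rfl⟩ := hg
      exact tendsto_fejerMean_fourier j x
    | zero => simp [fejerMean, fourierCoeff]
    | add g h _ _ hg hh =>
      simpa [fejerMean_add] using hg.add hh
    | smul c g _ hg =>
      simpa [fejerMean_smul] using hg.const_mul c
  rw [Metric.tendsto_atTop]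
  intro ε hε
  have hf : f ∈ closure (Submodule.span ℂ (Set.range (@fourier T)) : Set C(AddCircle T, ℂ)) := by
    rw [← Submodule.topologicalClosure_coe, span_fourier_closure_eq_top]
    trivial
  obtain ⟨g, hg, hfg⟩ := Metric.mem_closure_iff.1 hf (ε / 3) (by positivity)
  obtain ⟨N, hN⟩ := Metric.tendsto_atTop.1 (hspan g hg) (ε / 3) (by positivity)
  refine ⟨N, fun n hn => ?_⟩
  have h1 := hN n hn
  have h2 := norm_fejerMean_le (f - g) n x
  rw [ContinuousMap.coe_sub, fejerMean_sub, ← dist_eq_norm, ← dist_eq_norm] at h2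
  have h3 := ContinuousMap.dist_apply_le_dist (f := g) (g := f) x
  rw [dist_comm g f] at h3
  have h4 := dist_triangle4 (fejerMean f n x) (fejerMean g n x) (g x) (f x)
  linarith

end Fejer

/-! ### Periodic functions on the line and Fourier coefficients of derivatives. -/

section Derivatives
open MeasureTheory Filter Topology

theorem fourierHat_eq_fourierCoeff (f : C(AddCircle (2 * Real.pi), ℂ)) (k : ℤ) :
    fourierHat (fun x => f x) k =
      have : Fact (0 < 2 * Real.pi) := ⟨Real.two_pi_pos⟩
      fourierCoeff f k := by
  have : Fact (0 < 2 * Real.pi) := ⟨Real.two_pi_pos⟩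
  rw [fourierHat, fourierCoeffOn_eq_integral, fourierCoeff_eq_intervalIntegral f k (-Real.pi)]
  have h1 : Real.pi - -Real.pi = 2 * Real.pi := by ring
  have h2 : -Real.pi + 2 * Real.pi = Real.pi := by ring
  rw [h1, h2]

/-- **Fejér's theorem** for `2π`-periodic continuous functions on the line. -/
theorem tendsto_fejer_of_periodic {f : ℝ → ℂ} (hf : Continuous f)
    (hper : Function.Periodic f (2 * Real.pi)) (x : ℝ) :
    Tendsto (fun n : ℕ => (1 / (n : ℂ)) * ∑ m ∈ Finset.range n, ∑ k ∈ Finset.Icc (-(m : ℤ)) m,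
      fourierHat f k * Complex.exp (Complex.I * k * x)) atTop (𝓝 (f x)) := by
  have : Fact (0 < 2 * Real.pi) := ⟨Real.two_pi_pos⟩
  let F : C(AddCircle (2 * Real.pi), ℂ) :=
    ⟨hper.lift, continuous_coinduced_dom.2 hf⟩
  have hF : ∀ y : ℝ, F y = f y := fun y => hper.lift_coe y
  have h := tendsto_fejerMean F (x : AddCircle (2 * Real.pi))
  rw [hF] at h
  refine h.congr fun n => ?_
  simp only [fejerMean]
  refine congrArg _ (Finset.sum_congr rfl fun m _ => Finset.sum_congr rfl fun k _ => ?_)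
  rw [← fourierHat_eq_fourierCoeff, fourier_coe_apply, funext hF]
  congr 2
  have : (Real.pi : ℂ) ≠ 0 := by exact_mod_cast Real.pi_ne_zero
  push_cast
  field_simp

/-- Integration by parts, whose boundary terms cancel by periodicity. The frequency 0 is separate
because the general formula divides by k. -/
theorem fourierHat_deriv {f : ℝ → ℂ} (hf : ContDiff ℝ 1 f)
    (hper : Function.Periodic f (2 * Real.pi)) (k : ℤ) :
    fourierHat (deriv f) k = Complex.I * k * fourierHat f k := by
  have hd : ∀ x, HasDerivAt f (deriv f x) x := fun x =>
    (hf.differentiable one_ne_zero x).hasDerivAt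
  have hc : Continuous (deriv f) := hf.continuous_deriv le_rfl
  have hend : f Real.pi = f (-Real.pi) := by
    rw [← hper (-Real.pi)]
    congr 1
    ring
  rcases eq_or_ne k 0 with rfl | hk
  · rw [fourierHat, fourierCoeffOn_eq_integral]
    simp [intervalIntegral.integral_deriv_eq_sub' f rfl
      (fun x _ => (hd x).differentiableAt) hc.continuousOn, hend]
  · have h := fourierCoeffOn_of_hasDerivAt (neg_lt_self Real.pi_pos) hk (fun x _ => hd x)
      (hc.intervalIntegrable _ _)
    rw [hend, sub_self, mul_zero, zero_sub] at h
    rw [fourierHat, fourierHat, h]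
    have h1 : (Real.pi : ℂ) ≠ 0 := by exact_mod_cast Real.pi_ne_zero
    have h2 : (k : ℂ) ≠ 0 := by exact_mod_cast hk
    push_cast
    field_simp
    ring

theorem Function.Periodic.iteratedDeriv {f : ℝ → ℂ} {c : ℝ} (hf : Function.Periodic f c) (j : ℕ) :
    Function.Periodic (iteratedDeriv j f) c := by
  intro x
  have h := congrFun (iteratedDeriv_comp_add_const j f c) x
  rw [hf.funext] at h
  exact h.symm

theorem fourierHat_iteratedDeriv {f : ℝ → ℂ} (hper : Function.Periodic f (2 * Real.pi)) (j : ℕ)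
    (hf : ContDiff ℝ j f) (k : ℤ) :
    fourierHat (iteratedDeriv j f) k = (Complex.I * k) ^ j * fourierHat f k := by
  induction j with
  | zero => simp
  | succ j ih =>
    rw [iteratedDeriv_succ, fourierHat_deriv _ (hper.iteratedDeriv j),
      ih (hf.of_le (by exact_mod_cast j.le_succ)), pow_succ]
    · ring
    · rw [iteratedDeriv_eq_iterate]
      exact ContDiff.iterate_deriv' 1 j (by rwa [add_comm])

end Derivatives

/-! ### Exponentials of Jordan blocks and convergence of the matrix means. -/

section Exponential
open Matrix

theorem jordanBlock_zero_pow_apply (m j : ℕ) (p q : Fin m) :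
    (jordanBlock m 0 ^ j) p q = if (p : ℕ) + j = q then 1 else 0 := by
  induction j generalizing q with
  | zero => simp [Matrix.one_apply, Fin.ext_iff]
  | succ j ih =>
    rw [pow_succ, Matrix.mul_apply]
    simp only [ih, ite_mul, one_mul, zero_mul]
    by_cases h : (p : ℕ) + (j + 1) = q
    · rw [if_pos h, Finset.sum_eq_single ⟨(p : ℕ) + j, by omega⟩]
      · have h1 : (⟨(p : ℕ) + j, by omega⟩ : Fin m) ≠ q := fun h' => by
          have := congrArg Fin.val h'
          simp only at this
          omega
        simp [jordanBlock, h1, ← h, add_assoc]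
      · intro l _ hl
        exact if_neg fun h' => hl (Fin.ext h'.symm)
      · simp
    · rw [if_neg h]
      refine Finset.sum_eq_zero fun l _ => ?_
      split_ifs with hl
      · have h1 : (l : ℕ) + 1 ≠ q := by omega
        simp [jordanBlock, h1]
      · rfl

/-- The scalar part and the nilpotent shift commute, so the exponential factors, and the series of
the nilpotent part stops before order m. -/
theorem exp_smul_jordanBlock_apply (m : ℕ) (t : ℝ) (c : ℂ) (p q : Fin m) :
    NormedSpace.exp (c • jordanBlock m t) p q = if p ≤ q then
      Complex.exp (c * t) * c ^ ((q : ℕ) - p) / (Nat.factorial ((q : ℕ) - p) : ℂ) else 0 := by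
  have hJ : c • jordanBlock m t = (c * t) • (1 : Matrix (Fin m) (Fin m) ℂ) +
      c • jordanBlock m 0 := by
    ext i j
    by_cases h : i = j <;> simp [jordanBlock, h]
  have hexp : NormedSpace.exp ((c * t) • (1 : Matrix (Fin m) (Fin m) ℂ)) =
      Complex.exp (c * t) • (1 : Matrix (Fin m) (Fin m) ℂ) := by
    rw [← Matrix.diagonal_one, ← Matrix.diagonal_smul, Matrix.exp_diagonal, ← Matrix.diagonal_smul]
    congr 1
    ext i
    simp [Complex.exp_eq_exp_ℂ, NormedSpace.exp]
  rw [hJ, Matrix.exp_add_of_commute _ _ ((Commute.one_left _).smul_left _), hexp, smul_mul_assoc, one_mul,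
    Matrix.smul_apply]
  have hN : NormedSpace.exp (c • jordanBlock m 0) =
      ∑ j ∈ Finset.range m, ((Nat.factorial j : ℂ)⁻¹) • (c • jordanBlock m 0) ^ j := by
    rw [NormedSpace.exp_eq_tsum ℂ]
    refine tsum_eq_sum fun j hj => ?_
    have hj' : m ≤ j := by simpa using hj
    have : jordanBlock m 0 ^ j = 0 := by
      ext i l
      rw [jordanBlock_zero_pow_apply, if_neg (by omega)]
      rfl
    rw [smul_pow, this, smul_zero, smul_zero]
  rw [hN, Matrix.sum_apply]
  simp only [smul_pow, Matrix.smul_apply, jordanBlock_zero_pow_apply]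
  split_ifs with h
  · rw [Finset.sum_eq_single ((q : ℕ) - p)]
    · rw [if_pos (Nat.add_sub_cancel' h)]
      simp only [smul_eq_mul, mul_one]
      field_simp
    · intro j _ hj
      rw [if_neg (by omega), smul_zero, smul_zero]
    · intro hq
      exact absurd (Finset.mem_range.2 (by omega)) hq
  · rw [Finset.sum_eq_zero, smul_zero]
    intro j _
    rw [if_neg (by rw [Fin.le_def] at h; omega), smul_zero, smul_zero]

variable {d : ℕ} {X : Matrix (Fin d) (Fin d) ℂ}

/-- The map sending a family of blocks to `W diag(B₁, …, B_r) W⁻¹`. -/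
noncomputable def RealJordanDecomposition.ofBlocks (D : RealJordanDecomposition X) :
    (∀ i, Matrix (Fin (D.size i)) (Fin (D.size i)) ℂ) →ₗ[ℂ] Matrix (Fin d) (Fin d) ℂ where
  toFun B := (D.W : Matrix (Fin d) (Fin d) ℂ) * Matrix.reindex D.e D.e (Matrix.blockDiagonal' B)
    * ((D.W⁻¹ : (Matrix (Fin d) (Fin d) ℂ)ˣ) : Matrix (Fin d) (Fin d) ℂ)
  map_add' B C := by
    rw [Matrix.blockDiagonal'_add]
    simp [Matrix.mul_add, Matrix.add_mul, Matrix.submatrix_add]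
  map_smul' c B := by
    rw [Matrix.blockDiagonal'_smul]
    simp [Matrix.submatrix_smul]

theorem RealJordanDecomposition.exp_smul (D : RealJordanDecomposition X) (c : ℂ) :
    NormedSpace.exp (c • X) =
      D.ofBlocks fun i => NormedSpace.exp (c • jordanBlock (D.size i) (D.eig i)) := by
  have h1 : c • X = D.ofBlocks (c • fun i => jordanBlock (D.size i) (D.eig i)) := by
    rw [map_smul]
    exact congrArg _ D.eq
  have h2 : ∀ A : Matrix (Σ i, Fin (D.size i)) (Σ i, Fin (D.size i)) ℂ,
      NormedSpace.exp (Matrix.reindex D.e D.e A) = Matrix.reindex D.e D.e (NormedSpace.exp A) := by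
    intro A
    let φ := Matrix.reindexAlgEquiv ℂ ℂ D.e
    have key : φ (NormedSpace.exp A) = NormedSpace.exp (φ A) := by
      simp only [NormedSpace.exp_eq_tsum ℂ]
      -- Reindexing is an algebra isomorphism, continuous by finite dimension, so it maps the
      -- exponential series term by term.
      refine (φ.toLinearEquiv.toContinuousLinearEquiv.map_tsum
        (f := fun n : ℕ => ((Nat.factorial n : ℂ)⁻¹) • A ^ n)).trans (tsum_congr fun n => ?_)
      rw [LinearEquiv.coe_toContinuousLinearEquiv', AlgEquiv.toLinearEquiv_apply, map_smul, map_pow]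
    exact key.symm
  rw [h1]
  simp only [RealJordanDecomposition.ofBlocks, LinearMap.coe_mk, AddHom.coe_mk]
  rw [Matrix.exp_units_conj, h2, Matrix.exp_blockDiagonal']
  congr
  ext i : 1
  exact open scoped Matrix.Norms.Operator in
    Pi.coe_exp (𝔸 := fun i => Matrix (Fin (D.size i)) (Fin (D.size i)) ℂ) _ i

theorem RealJordanDecomposition.tendsto_matrixFejerMean (D : RealJordanDecomposition X) {f : ℝ → ℂ}
    (hf : ContDiff ℝ ((d - 1 : ℕ) : WithTop ℕ∞) f) (hper : Function.Periodic f (2 * Real.pi)) :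
    Filter.Tendsto (fun n : ℕ => matrixFejerMean f X n) Filter.atTop
      (nhds (D.applyFunction f)) := by
  have hsize : ∀ i, D.size i ≤ d := by
    intro i
    simpa using Fintype.card_le_of_injective _ (D.e.injective.comp (sigma_mk_injective (i := i)))
  have hmean : ∀ n, matrixFejerMean f X n = D.ofBlocks fun i =>
      matrixFejerMean f (jordanBlock (D.size i) (D.eig i)) n := by
    intro n
    simp only [matrixFejerMean, matrixFourierPartialSum, D.exp_smul, ← map_smul, ← map_sum]
    congr 1
    ext1 i
    simp
  have hcont : Continuous D.ofBlocks := LinearMap.continuous_of_finiteDimensional _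
  simp only [hmean]
  refine (hcont.tendsto _).comp (tendsto_pi_nhds.2 fun i => ?_)
  refine tendsto_pi_nhds.2 fun p => tendsto_pi_nhds.2 fun q => ?_
  simp only [matrixFejerMean, matrixFourierPartialSum, Matrix.smul_apply, Matrix.sum_apply,
    exp_smul_jordanBlock_apply, jordanBlockFunction, Matrix.of_apply]
  split_ifs with hpq
  -- A block has size at most d, so only derivatives up to order d - 1 occur.
  · have hj : (q : ℕ) - p ≤ d - 1 := by have := hsize i; omega
    have hfj : ContDiff ℝ (((q : ℕ) - p : ℕ) : WithTop ℕ∞) f := hf.of_le (by exact_mod_cast hj)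
    have h := (tendsto_fejer_of_periodic (hfj.continuous_iteratedDeriv _ le_rfl)
      (hper.iteratedDeriv _) (D.eig i)).div_const (Nat.factorial ((q : ℕ) - p) : ℂ)
    refine h.congr fun n => ?_
    simp only [fourierHat_iteratedDeriv hper _ hfj, smul_eq_mul, mul_div_assoc, Finset.sum_div]
    refine congrArg _ (Finset.sum_congr rfl fun m _ => Finset.sum_congr rfl fun k _ => ?_)
    ring
  · simp

end Exponential

theorem mainTheorem4 (d : ℕ) (X : Matrix (Fin d) (Fin d) ℂ)
    (hX : ∀ z ∈ spectrum ℂ X, z.im = 0)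
    (f : ℝ → ℂ) (hf : ContDiff ℝ ((d - 1 : ℕ) : WithTop ℕ∞) f)
    (hper : Function.Periodic f (2 * Real.pi)) :
    (∃! F : Matrix (Fin d) (Fin d) ℂ, IsMatrixFunction f X F) ∧
    ∀ F : Matrix (Fin d) (Fin d) ℂ, IsMatrixFunction f X F →
      Filter.Tendsto (fun n : ℕ => matrixFejerMean f X n) Filter.atTop (nhds F) := by
  obtain ⟨D⟩ := nonempty_realJordanDecomposition X hX
  have hlim : ∀ F : Matrix (Fin d) (Fin d) ℂ, IsMatrixFunction f X F →
      Filter.Tendsto (fun n : ℕ => matrixFejerMean f X n) Filter.atTop (nhds F) := by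
    rintro F ⟨D', rfl⟩
    exact D'.tendsto_matrixFejerMean hf hper
  -- Any two values are limits of the same sequence, hence equal.
  exact ⟨⟨D.applyFunction f, ⟨D, rfl⟩, fun F hF =>
    tendsto_nhds_unique (hlim F hF) (hlim _ ⟨D, rfl⟩)⟩, hlim⟩
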